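/- All Banach spaces are real. For a bounded sequence $(x_k)$ in a Banach space $X$ put $\operatorname{ca}(x_k)=\inf_{n}\operatorname{diam}\{x_k: k\ge n\}$, and let $\delta(x_k)$ be the diameter of the set of all weak* cluster points of $(x_k)$ in $X^{**}$. The space $X$ has the Schur property if every weakly convergent sequence in $X$ is norm convergent; for $C\ge 0$ it has the $C$-Schur property if $\operatorname{ca}(x_k)\le C\,\delta(x_k)$ for every bounded sequence $(x_k)$ in $X$; it is $L$-embedded if there is a linear projection $P$ of $X^{**}$ onto (the canonical image of) $X$ with $\|Px^{**}\|+\|x^{**}-Px^{**}\|=\|x^{**}\|$ for all $x^{**}\in X^{**}$. For $\alpha>0$ let $Y_\alpha=(\ell_1,\alpha\|\cdot\|_1)\oplus_1(\ell_2,\|\cdot\|_2)$, let $x_k=(e_k,e_k)\in Y_\alpha$, where $e_k$ is the $k$-th canonical basic vector, and let $X_\alpha$ be the closed linear span of $\{x_k:k\in\mathbb N\}$ in $Y_\alpha$. Let $X=\left(\sum_{n=1}^\infty X_{1/n}\right)_{\ell_1}$ be the $\ell_1$-sum of the spaces $X_{1/n}$, $n\ge 1$. Then: 1. $X$ is a separable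 $L$-embedded Banach space with the Schur property which fails the $C$-Schur property for every $C\ge 0$. In particular, such a space exists. 2. For every $\alpha>0$ the sequence $(x_k)$ is bounded in $X_\alpha$ and, computed in $X_\alpha$, $\operatorname{ca}(x_k)=2\alpha+\sqrt2$ and $\delta(x_k)=2\alpha$. -/

import Mathlib

open Filter Topology

namespace QuantSchur

noncomputable section

/-! ### Quantitative notions for a real normed space -/

section Notions

variable {X : Type*} [NormedAddCommGroup X] [NormedSpace ℝ X]

/-- The weak* cluster points, in the bidual of `X`, of a sequence in `X`. -/
def weakStarClusterPts (x : ℕ → X) : Set (StrongDual ℝ (StrongDual ℝ X)) :=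
  {φ | MapClusterPt (StrongDual.toWeakDual φ) atTop
    (fun k => StrongDual.toWeakDual (NormedSpace.inclusionInDoubleDual ℝ X (x k)))}

/-- `δ(x_k)`: the diameter of the set of weak* cluster points. It is used for bounded sequences
only; then this set is nonempty and bounded. -/
def delta (x : ℕ → X) : ℝ := Metric.diam (weakStarClusterPts x)

/-- `ca(x_k) = inf_n diam {x_k : k ≥ n}`, used for bounded sequences only. -/
def ca (x : ℕ → X) : ℝ := ⨅ n : ℕ, Metric.diam (x '' Set.Ici n)

variable (X)

/-- The Schur property: weakly convergent sequences converge in norm. -/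
def HasSchurProperty : Prop :=
  ∀ (x : ℕ → X) (a : X),
    Tendsto (fun k => toWeakSpace ℝ X (x k)) atTop (𝓝 (toWeakSpace ℝ X a)) →
      Tendsto x atTop (𝓝 a)

/-- The `C`-Schur property: `ca(x_k) ≤ C δ(x_k)` for each bounded sequence. -/
def HasCSchurProperty (C : ℝ) : Prop :=
  ∀ x : ℕ → X, Bornology.IsBounded (Set.range x) → ca x ≤ C * delta x

/-- `X` is `L`-embedded: there is a projection `P` of the bidual onto the canonical image of `X`
with `‖φ‖ = ‖P φ‖ + ‖φ - P φ‖` for all `φ`. -/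
def IsLEmbedded : Prop :=
  ∃ P : StrongDual ℝ (StrongDual ℝ X) →L[ℝ] StrongDual ℝ (StrongDual ℝ X),
    (∀ φ, P (P φ) = P φ) ∧
      Set.range P = Set.range (NormedSpace.inclusionInDoubleDual ℝ X) ∧
      ∀ φ, ‖P φ‖ + ‖φ - P φ‖ = ‖φ‖

end Notions

/-! ### The space `E` with the norm multiplied by `α > 0` -/

/-- The vector space `E` equipped with the norm `α ‖·‖`, where `α > 0`. -/
def Scaled (_α : {a : ℝ // 0 < a}) (E : Type*) : Type _ := E

namespace Scaled

variable (α : {a : ℝ // 0 < a}) (E : Type*) [NormedAddCommGroup E] [NormedSpace ℝ E]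

instance : AddCommGroup (Scaled α E) := inferInstanceAs (AddCommGroup E)

instance : Module ℝ (Scaled α E) := inferInstanceAs (Module ℝ E)

/-- The identity map from `E` to `E` with the norm `α ‖·‖`. -/
def of : E ≃ₗ[ℝ] Scaled α E := LinearEquiv.refl ℝ E

instance : Norm (Scaled α E) := ⟨fun x => (α : ℝ) * ‖(of α E).symm x‖⟩

theorem norm_def (x : Scaled α E) : ‖x‖ = (α : ℝ) * ‖(of α E).symm x‖ := rfl

theorem core : NormedSpace.Core ℝ (Scaled α E) where
  norm_nonneg x := mul_nonneg α.2.le (norm_nonneg _)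
  norm_smul c x := by
    rw [norm_def, norm_def, map_smul, norm_smul]
    ring
  norm_triangle x y := by
    rw [norm_def, norm_def, norm_def, map_add, ← mul_add]
    exact mul_le_mul_of_nonneg_left (norm_add_le _ _) α.2.le
  norm_eq_zero_iff x := by
    rw [norm_def, mul_eq_zero, or_iff_right α.2.ne', norm_eq_zero,
      LinearEquiv.map_eq_zero_iff]

instance : NormedAddCommGroup (Scaled α E) := NormedAddCommGroup.ofCore (core α E)

instance : NormedSpace ℝ (Scaled α E) := NormedSpace.ofCore (core α E)

end Scaled

/-! ### The construction -/

/-- The real sequence space `ℓ₁`. -/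
abbrev Ell1 : Type := lp (fun _ : ℕ => ℝ) 1

/-- The real sequence space `ℓ₂`. -/
abbrev Ell2 : Type := lp (fun _ : ℕ => ℝ) 2

/-- `Y_α = (ℓ₁, α ‖·‖₁) ⊕₁ (ℓ₂, ‖·‖₂)`. -/
abbrev Y (α : {a : ℝ // 0 < a}) : Type := WithLp 1 (Scaled α Ell1 × Ell2)

/-- The vector `(e_k, e_k)` of `Y_α`. -/
def diagVec (α : {a : ℝ // 0 < a}) (k : ℕ) : Y α :=
  WithLp.toLp 1 (Scaled.of α Ell1 (lp.single 1 k 1), lp.single 2 k 1)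

/-- `X_α`: the closed linear span of the vectors `(e_k, e_k)` in `Y_α`. -/
def XSub (α : {a : ℝ // 0 < a}) : Submodule ℝ (Y α) :=
  (Submodule.span ℝ (Set.range (diagVec α))).topologicalClosure

/-- The vector `x_k = (e_k, e_k)`, as an element of `X_α`. -/
def xvec (α : {a : ℝ // 0 < a}) (k : ℕ) : XSub α :=
  ⟨diagVec α k, Submodule.le_topologicalClosure _ (Submodule.subset_span ⟨k, rfl⟩)⟩

/-- The parameters `1, 1/2, 1/3, …`. -/
def invNat (n : ℕ) : {a : ℝ // 0 < a} := ⟨1 / ((n : ℝ) + 1), by positivity⟩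

/-- The `ℓ₁`-sum of the spaces `X_{1/n}`, `n = 1, 2, 3, …`. -/
abbrev XSum : Type := lp (fun n : ℕ => XSub (invNat n)) 1

end

end QuantSchur

/-!
Write `‖·‖₁` and `‖·‖₂` for the norms of `ℓ₁` and `ℓ₂`. The elements of `X_α` are the pairs `(a, a)`
with `a ∈ ℓ₁`, so `X_α` is `ℓ₁` with the equivalent norm `α ‖a‖₁ + ‖a‖₂`. Everything is deduced from
this formula on the span of the basis (`IsMixedBasis`).

The distance of two basis vectors is `2 α + √2`, which is the value of `ca`. For `δ`, a sum of `m`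
signed basis vectors has norm `α m + √m`, so a functional of norm one is asymptotically bounded by
`α` along the basis (`eventually_abs_apply_le`): the `ℓ₂`-part is invisible to the cluster points,
which therefore have norm at most `α`. The functional `a ↦ α ∑ (-1)ᵏ aₖ` shows that `2 α` is
attained.
In the `ℓ₁`-sum the same bases give `ca = 2/n + √2` and `δ ≤ 2/n`, so no `C`-Schur property
holds.

The Schur property passes to `ℓ₁`-sums by a gliding hump argument (`HasSchurProperty.lp_one`). It
therefore holds for `ℓ₁`, for its isomorphic copies `X_α`, and for their `ℓ₁`-sum.

For `L`-embeddedness, the projection sends `φ` in the bidual to the element `x` with the same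
coordinates, which exists since the truncations of `x` are bounded by `‖φ‖`. For
`‖φ‖ ≥ ‖x‖ + ‖φ - x‖` let `G` norm `x`, let `F` almost norm `φ - x`, both in the unit ball, and let
`P` be the projection onto the first `K` coordinates in each of the first `N` summands. As `φ - x`
vanishes on the coordinate functionals, `F + (G - F) ∘ P` agrees with `F` on `φ - x`, and it almost
agrees with `G` at `x`. Its norm is at most `1 + ε` for large `K`
(`eventually_norm_add_sum_box_le`): on tails of the `n`-th summand `F` is bounded by
`(1 + ε) α ‖·‖₁`, by the averaging argument above, and in `α ‖·‖₁ + ‖·‖₂` the `ℓ₁`-part is additive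
while the `ℓ₂`-part does not increase under truncation.
-/

open Filter Topology

namespace QuantSchur

/-! ### The Schur property -/

section General

variable {X : Type*} [NormedAddCommGroup X] [NormedSpace ℝ X]

theorem hasSchurProperty_iff :
    HasSchurProperty X ↔ ∀ x : ℕ → X,
      (∀ F : StrongDual ℝ X, Tendsto (fun k => F (x k)) atTop (𝓝 0)) → Tendsto x atTop (𝓝 0) := by
  have key : ∀ (x : ℕ → X) (a : X),
      Tendsto (fun k => toWeakSpace ℝ X (x k)) atTop (𝓝 (toWeakSpace ℝ X a)) ↔
        ∀ F : StrongDual ℝ X, Tendsto (fun k => F (x k)) atTop (𝓝 (F a)) := by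
    intro x a
    refine WeakBilin.tendsto_iff_forall_eval_tendsto (topDualPairing ℝ X).flip ?_
    intro u v huv
    exact SeparatingDual.eq_iff_forall_dual_eq (R := ℝ) |>.2 fun F => LinearMap.congr_fun huv F
  constructor
  · intro h x hx
    refine h x 0 ((key x 0).2 fun F => ?_)
    simpa using hx F
  · intro h x a hxa
    rw [tendsto_iff_norm_sub_tendsto_zero]
    refine (h (fun k => x k - a) fun F => ?_).norm.trans (by simp)
    simpa using ((key x a).1 hxa F).sub_const (F a)

/-- The Schur property passes to spaces which embed into a Schur space. -/
theorem HasSchurProperty.of_bound {Z : Type*} [NormedAddCommGroup Z] [NormedSpace ℝ Z]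
    (hX : HasSchurProperty X) (T : Z →L[ℝ] X) (K : ℝ) (hT : ∀ z, ‖z‖ ≤ K * ‖T z‖) :
    HasSchurProperty Z := by
  rw [hasSchurProperty_iff] at hX ⊢
  intro x hx
  have h := (hX (fun k => T (x k)) fun F => hx (F.comp T)).norm.const_mul K
  rw [norm_zero, mul_zero] at h
  exact squeeze_zero_norm (fun k => hT (x k)) h

theorem hasSchurProperty_real : HasSchurProperty ℝ :=
  hasSchurProperty_iff.2 fun _ hx => hx (ContinuousLinearMap.id ℝ ℝ)

end General

/-! ### Functionals on `ℓ₁`-sums and the gliding hump -/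

section EllOneSum

variable {E : ℕ → Type*} [∀ n, NormedAddCommGroup (E n)]

theorem hasSum_norm_lp_one (z : lp E 1) : HasSum (fun n => ‖z n‖) ‖z‖ := by
  simpa using lp.hasSum_norm (p := 1) (by simp) z

variable [∀ n, NormedSpace ℝ (E n)]

/-- The coordinate projection of an `ℓ₁`-sum onto its `n`-th summand. -/
noncomputable def lpOneProj (n : ℕ) : lp E 1 →L[ℝ] E n :=
  LinearMap.mkContinuous
    { toFun := fun z => z n
      map_add' := fun _ _ => rfl
      map_smul' := fun _ _ => rfl } 1
    fun z => (lp.norm_apply_le_norm one_ne_zero z n).trans_eq (one_mul _).symm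

theorem summable_dual_apply (f : ∀ n, StrongDual ℝ (E n)) (hf : ∀ n, ‖f n‖ ≤ 1) (z : lp E 1) :
    Summable fun n => f n (z n) :=
  (hasSum_norm_lp_one z).summable.of_norm_bounded
    fun n => by simpa using (f n).le_of_opNorm_le (hf n) (z n)

/-- A family of functionals in the unit balls of the summands, as a functional on the
`ℓ₁`-sum. -/
noncomputable def lpOneDual (f : ∀ n, StrongDual ℝ (E n)) (hf : ∀ n, ‖f n‖ ≤ 1) :
    StrongDual ℝ (lp E 1) :=
  LinearMap.mkContinuous
    { toFun := fun z => ∑' n, f n (z n)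
      map_add' := fun z w => by
        rw [← (summable_dual_apply f hf z).tsum_add (summable_dual_apply f hf w)]
        simp
      map_smul' := fun c z => by
        rw [RingHom.id_apply, smul_eq_mul, ← tsum_mul_left]
        simp } 1
    fun z => by
      rw [one_mul]
      exact tsum_of_norm_bounded (hasSum_norm_lp_one z)
        fun n => by simpa using (f n).le_of_opNorm_le (hf n) (z n)

theorem lpOneDual_apply (f : ∀ n, StrongDual ℝ (E n)) (hf : ∀ n, ‖f n‖ ≤ 1) (z : lp E 1) :
    lpOneDual f hf z = ∑' n, f n (z n) := rfl

/-- The isometric embedding of the `n`-th summand into an `ℓ₁`-sum. -/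
noncomputable def lpOneInj (n : ℕ) : E n →L[ℝ] lp E 1 := lp.singleContinuousLinearMap ℝ E 1 n

theorem norm_lpOneInj (n : ℕ) (w : E n) : ‖lpOneInj n w‖ = ‖w‖ := lp.norm_single zero_lt_one n w

theorem norm_sum_lpOneInj (w : ∀ n, E n) (A : Finset ℕ) :
    ‖∑ n ∈ A, lpOneInj n (w n)‖ = ∑ n ∈ A, ‖w n‖ := by
  have h := lp.norm_sum_single (p := 1) (by simp) w A
  simp only [ENNReal.toReal_one, Real.rpow_one] at h
  exact h

theorem norm_sub_sum_lpOneInj (z : lp E 1) (A : Finset ℕ) :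
    ‖z - ∑ n ∈ A, lpOneInj n (z n)‖ = ‖z‖ - ∑ n ∈ A, ‖z n‖ := by
  have h := lp.norm_compl_sum_single (p := 1) (by simp) z A
  simp only [ENNReal.toReal_one, Real.rpow_one] at h
  exact h

theorem tendsto_sum_lpOneInj (z : lp E 1) :
    Tendsto (fun N => ∑ n ∈ Finset.range N, lpOneInj n (z n)) atTop (𝓝 z) :=
  (lp.hasSum_single (p := 1) ENNReal.one_ne_top z).tendsto_sum_nat

/-- Gliding hump: if the coordinates of a sequence tend to zero and its norms do not, then some
functional stays away from zero on a subsequence. -/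
theorem HasSchurProperty.lp_one (h : ∀ n, HasSchurProperty (E n)) : HasSchurProperty (lp E 1) := by
  rw [hasSchurProperty_iff]
  intro x hx
  have hcoord : ∀ n, Tendsto (fun k => x k n) atTop (𝓝 0) := fun n =>
    hasSchurProperty_iff.1 (h n) _ fun F => hx (F.comp (lpOneProj n))
  by_contra hcon
  obtain ⟨ε, hε, hfreq⟩ : ∃ ε > 0, ∀ N, ∃ k ≥ N, ε ≤ ‖x k‖ := by
    rw [Metric.tendsto_atTop] at hcon
    push Not at hcon
    simpa using hcon
  -- The mass of `x k` outside the block `[N, M)` is at most `ε / 4`.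
  have step : ∀ N : ℕ, ∃ k M : ℕ, N ≤ k ∧ N < M ∧ ε ≤ ‖x k‖ ∧
      ‖x k‖ - ε / 4 ≤ ∑ n ∈ Finset.Ico N M, ‖x k n‖ := by
    intro N
    have h0 : Tendsto (fun k => ∑ n ∈ Finset.range N, ‖x k n‖) atTop (𝓝 0) := by
      simpa using tendsto_finsetSum (Finset.range N) fun n _ => (hcoord n).norm
    obtain ⟨k₀, hk₀⟩ := eventually_atTop.1 (h0.eventually_lt_const (show 0 < ε / 8 by positivity))
    obtain ⟨k, hk, hεk⟩ := hfreq (max k₀ N)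
    have h1 := (hasSum_norm_lp_one (x k)).tendsto_sum_nat.eventually_const_lt
      (show ‖x k‖ - ε / 8 < ‖x k‖ by linarith)
    obtain ⟨M, hM, hNM⟩ := (h1.and (eventually_gt_atTop N)).exists
    refine ⟨k, M, le_of_max_le_right hk, hNM, hεk, ?_⟩
    have h2 := hk₀ k (le_of_max_le_left hk)
    have h3 := Finset.sum_range_add_sum_Ico (fun n => ‖x k n‖) hNM.le
    linarith
  choose k M hk hM hεk hblock using step
  set N : ℕ → ℕ := fun i => M^[i] 0 with hN
  have hNs : ∀ i, N (i + 1) = M (N i) := fun i => Function.iterate_succ_apply' M i 0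
  have hmono : StrictMono N := strictMono_nat_of_lt_succ fun i => by rw [hNs]; exact hM _
  have hsign : ∀ n, ∃ f : StrongDual ℝ (E n), ‖f‖ ≤ 1 ∧
      ∀ i, N i ≤ n → n < N (i + 1) → f (x (k (N i)) n) = ‖x (k (N i)) n‖ := by
    intro n
    by_cases hn : ∃ i, N i ≤ n ∧ n < N (i + 1)
    · obtain ⟨i, hi, hi'⟩ := hn
      obtain ⟨g, hg, hgx⟩ := exists_dual_vector'' ℝ (x (k (N i)) n)
      refine ⟨g, hg, fun j hj hj' => ?_⟩
      -- The blocks are disjoint, so `n` lies in one of them only.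
      have hij : i < j + 1 := hmono.lt_iff_lt.1 (hi.trans_lt hj')
      have hji : j < i + 1 := hmono.lt_iff_lt.1 (hj.trans_lt hi')
      obtain rfl : j = i := by omega
      exact hgx
    · exact ⟨0, by simp, fun i hi hi' => absurd ⟨i, hi, hi'⟩ hn⟩
  choose f hf hfx using hsign
  have hlow : ∀ i, ε / 2 ≤ lpOneDual f hf (x (k (N i))) := by
    intro i
    set z := x (k (N i)) with hz
    have hs := (summable_dual_apply f hf z).hasSum.add (hasSum_norm_lp_one z)
    -- The terms `f n (z n) + ‖z n‖` are nonnegative, so the sum over one block is a lower bound.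
    have h1 : ∑ n ∈ Finset.Ico (N i) (N (i + 1)), (f n (z n) + ‖z n‖) ≤
        lpOneDual f hf z + ‖z‖ := by
      refine sum_le_hasSum _ (fun n _ => ?_) hs
      have := (f n).le_of_opNorm_le (hf n) (z n)
      rw [Real.norm_eq_abs, one_mul] at this
      linarith [neg_abs_le (f n (z n))]
    have h2 : ∑ n ∈ Finset.Ico (N i) (N (i + 1)), (f n (z n) + ‖z n‖) =
        2 * ∑ n ∈ Finset.Ico (N i) (N (i + 1)), ‖z n‖ := by
      rw [Finset.mul_sum]
      refine Finset.sum_congr rfl fun n hn => ?_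
      rw [Finset.mem_Ico] at hn
      rw [hfx n i hn.1 hn.2]
      ring
    have h3 := hblock (N i)
    rw [← hNs, ← hz] at h3
    have h4 := hεk (N i)
    rw [← hz] at h4
    linarith
  have hki : Tendsto (fun i => k (N i)) atTop atTop :=
    tendsto_atTop_mono (fun i => (hmono.le_apply (x := i)).trans (hk _)) tendsto_id
  have := ge_of_tendsto' ((hx (lpOneDual f hf)).comp hki) hlow
  linarith

end EllOneSum

/-! ### Weak* cluster points -/

section Clusters

variable {X : Type*} [NormedAddCommGroup X] [NormedSpace ℝ X]

theorem mapClusterPt_apply {x : ℕ → X} {φ : StrongDual ℝ (StrongDual ℝ X)}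
    (hφ : φ ∈ weakStarClusterPts x) (F : StrongDual ℝ X) :
    MapClusterPt (φ F) atTop fun k => F (x k) :=
  MapClusterPt.continuousAt_comp (f := fun ψ : WeakDual ℝ (StrongDual ℝ X) => ψ F)
    (WeakDual.eval_continuous F).continuousAt hφ

theorem norm_le_of_mem_weakStarClusterPts {x : ℕ → X} {α : ℝ} (hα : 0 ≤ α)
    (h : ∀ F : StrongDual ℝ X, ‖F‖ ≤ 1 → ∀ ε > 0, ∀ᶠ k in atTop, |F (x k)| ≤ α + ε)
    {φ : StrongDual ℝ (StrongDual ℝ X)} (hφ : φ ∈ weakStarClusterPts x) : ‖φ‖ ≤ α := by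
  refine ContinuousLinearMap.opNorm_le_of_unit_norm hα fun F hF => ?_
  refine le_of_forall_pos_le_add fun ε hε => ?_
  by_contra! hlt
  obtain ⟨k, hk, hk'⟩ := (((mapClusterPt_apply hφ F).frequently
    ((isOpen_lt continuous_const continuous_norm).mem_nhds hlt)).and_eventually
      (h F hF.le ε hε)).exists
  exact absurd hk' (not_le.2 hk)

theorem delta_le {x : ℕ → X} {α : ℝ} (hα : 0 ≤ α)
    (h : ∀ F : StrongDual ℝ X, ‖F‖ ≤ 1 → ∀ ε > 0, ∀ᶠ k in atTop, |F (x k)| ≤ α + ε) :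
    delta x ≤ 2 * α := by
  refine Metric.diam_le_of_forall_dist_le (by positivity) fun φ hφ ψ hψ => ?_
  refine (dist_eq_norm φ ψ).trans_le ?_
  have := norm_sub_le φ ψ
  have := norm_le_of_mem_weakStarClusterPts hα h hφ
  have := norm_le_of_mem_weakStarClusterPts hα h hψ
  linarith

/-- A subsequence of a bounded sequence has a weak* cluster point, by Banach–Alaoglu. -/
theorem exists_weakStarClusterPt_subseq {x : ℕ → X} (hx : Bornology.IsBounded (Set.range x))
    {u : ℕ → ℕ} (hu : Tendsto u atTop atTop) :
    ∃ φ ∈ weakStarClusterPts x, φ ∈ weakStarClusterPts (x ∘ u) := by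
  obtain ⟨R, hR⟩ := isBounded_iff_forall_norm_le.1 hx
  obtain ⟨ψ, -, hψ⟩ := (WeakDual.isCompact_closedBall (𝕜 := ℝ)
    (0 : StrongDual ℝ (StrongDual ℝ X)) R).exists_mapClusterPt (f := atTop)
    (u := fun k => StrongDual.toWeakDual (NormedSpace.inclusionInDoubleDual ℝ X (x (u k))))
    (by
      refine tendsto_principal.2 (Eventually.of_forall fun k => ?_)
      refine mem_closedBall_zero_iff.2 ?_
      exact (NormedSpace.double_dual_bound ℝ X _).trans (hR _ ⟨_, rfl⟩))
  exact ⟨WeakDual.toStrongDual ψ, MapClusterPt.of_comp hu hψ, hψ⟩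

/-- A functional that separates two subsequences bounds `delta` from below. -/
theorem sub_le_delta {x : ℕ → X} (hx : Bornology.IsBounded (Set.range x))
    {u v : ℕ → ℕ} (hu : Tendsto u atTop atTop) (hv : Tendsto v atTop atTop)
    {F : StrongDual ℝ X} (hF : ‖F‖ ≤ 1) {a b : ℝ} (ha : ∀ k, F (x (u k)) = a)
    (hb : ∀ k, F (x (v k)) = b) : a - b ≤ delta x := by
  have hval : ∀ {w : ℕ → ℕ} {r : ℝ} {φ : StrongDual ℝ (StrongDual ℝ X)},
      φ ∈ weakStarClusterPts (x ∘ w) → (∀ k, F (x (w k)) = r) → φ F = r := by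
    intro w r φ hφ hr
    have h := mapClusterPt_apply hφ F
    simp only [Function.comp_apply, hr] at h
    by_contra hne
    exact h.frequently (p := fun y => y ≠ r) (eventually_ne_nhds hne)
      (Eventually.of_forall fun _ => not_not.2 rfl)
  obtain ⟨φ, hφ, hφu⟩ := exists_weakStarClusterPt_subseq hx hu
  obtain ⟨ψ, hψ, hψv⟩ := exists_weakStarClusterPt_subseq hx hv
  have hbdd : Bornology.IsBounded (weakStarClusterPts x) := by
    obtain ⟨R, hR⟩ := isBounded_iff_forall_norm_le.1 hx
    have hR0 : 0 ≤ R := (norm_nonneg _).trans (hR _ ⟨0, rfl⟩)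
    refine isBounded_iff_forall_norm_le.2 ⟨R, fun θ hθ => ?_⟩
    refine norm_le_of_mem_weakStarClusterPts hR0 (fun G hG ε hε => ?_) hθ
    refine Eventually.of_forall fun k => ?_
    have h1 := G.le_of_opNorm_le hG (x k)
    have h2 := hR _ ⟨k, rfl⟩
    rw [Real.norm_eq_abs, one_mul] at h1
    linarith
  calc a - b = (φ - ψ) F := by rw [sub_apply, hval hφu ha, hval hψv hb]
    _ ≤ ‖(φ - ψ) F‖ := Real.le_norm_self _
    _ ≤ ‖φ - ψ‖ := by simpa using (φ - ψ).le_opNorm_of_le hF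
    _ ≤ delta x := (dist_eq_norm φ ψ).symm.trans_le (Metric.dist_le_diam_of_mem hbdd hφ hψ)

/-- Averaging: if signed sums of `m` vectors of a sequence have norm at most `α m + √m`, then
a functional of norm at most one is asymptotically bounded by `α` along the sequence. -/
theorem eventually_abs_apply_le {x : ℕ → X} {α : ℝ}
    (h : ∀ (A : Finset ℕ) (σ : ℕ → ℝ), (∀ k, |σ k| ≤ 1) →
      ‖∑ k ∈ A, σ k • x k‖ ≤ α * A.card + √A.card)
    {F : StrongDual ℝ X} (hF : ‖F‖ ≤ 1) {ε : ℝ} (hε : 0 < ε) :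
    ∀ᶠ k in atTop, |F (x k)| ≤ α + ε := by
  by_contra hcon
  have hinf : {k | ¬ |F (x k)| ≤ α + ε}.Infinite :=
    Nat.frequently_atTop_iff_infinite.1 (not_eventually.1 hcon)
  -- A set of `m > 1 / ε ^ 2` such indices gives `m (α + ε) ≤ α m + √m`, a contradiction.
  obtain ⟨m, hm⟩ := exists_nat_gt (1 / ε ^ 2)
  obtain ⟨A, hA, rfl⟩ := hinf.exists_subset_card_eq m
  have hcard : (0 : ℝ) < A.card := lt_trans (by positivity) hm
  have h1 := F.le_of_opNorm_le_of_le hF (h A (fun k => SignType.sign (F (x k))) fun k => by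
    rcases lt_trichotomy (F (x k)) 0 with h | h | h <;> simp [h])
  have h2 : (A.card : ℝ) * (α + ε) ≤ ∑ k ∈ A, |F (x k)| := by
    rw [← nsmul_eq_mul]
    exact Finset.card_nsmul_le_sum _ _ _ fun k hk => (not_le.1 (hA hk)).le
  have h3 : F (∑ k ∈ A, ((SignType.sign (F (x k)) : SignType) : ℝ) • x k) =
      ∑ k ∈ A, |F (x k)| := by
    rw [map_sum]
    exact Finset.sum_congr rfl fun k _ => by rw [map_smul, smul_eq_mul, sign_mul_self]
  rw [h3, one_mul] at h1
  have h4 := (h2.trans (Real.le_norm_self _)).trans h1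
  have h5 : ε * A.card ≤ √A.card := by linarith
  have h6 := Real.sq_sqrt hcard.le
  have h7 : (ε * A.card) ^ 2 ≤ A.card := by
    exact (pow_le_pow_left₀ (by positivity) h5 2).trans_eq h6
  rw [div_lt_iff₀ (by positivity)] at hm
  nlinarith

end Clusters

/-! ### Sequences of equidistant points -/

/-- A sequence whose distinct terms have constant mutual distance `r` has `ca` equal to `r`. -/
theorem ca_eq_of_norm_sub {X : Type*} [NormedAddCommGroup X] {x : ℕ → X} {r : ℝ}
    (hr : 0 ≤ r) (h : ∀ j k, j ≠ k → ‖x j - x k‖ = r) : ca x = r := by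
  have hdist : ∀ j k, dist (x j) (x k) ≤ r := by
    intro j k
    rcases eq_or_ne j k with rfl | hjk
    · rwa [dist_self]
    · rw [dist_eq_norm, h j k hjk]
  have key : ∀ n, Metric.diam (x '' Set.Ici n) = r := by
    intro n
    have hall : ∀ y ∈ x '' Set.Ici n, ∀ z ∈ x '' Set.Ici n, dist y z ≤ r := by
      rintro _ ⟨j, -, rfl⟩ _ ⟨k, -, rfl⟩
      exact hdist j k
    refine le_antisymm (Metric.diam_le_of_forall_dist_le hr hall) ?_
    rw [← h n (n + 1) (by omega), ← dist_eq_norm]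
    exact Metric.dist_le_diam_of_mem (Metric.isBounded_iff.2 ⟨r, fun y hy z hz => hall y hy z hz⟩)
      ⟨n, Set.self_mem_Ici, rfl⟩ ⟨n + 1, Nat.le_succ n, rfl⟩
  simp [ca, key]

/-! ### A criterion for `L`-embeddedness -/

section LEmbedded

variable {X Γ ι : Type*} [NormedAddCommGroup X] [NormedSpace ℝ X] {e : Γ → X}
  {c : Γ → StrongDual ℝ X} {l : Filter ι} [l.NeBot] {A : ι → Finset Γ}

/-- If `x` has the same coordinates as `φ`, then the norm is additive on `φ = x + (φ - x)`: let `G`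
norm `x` and let `F` almost norm `φ - x`. The functional `F + (G - F) ∘ P_A` has norm almost one,
agrees with `F` on `φ - x`, which vanishes on the coordinate functionals, and almost agrees with `G`
at `x`. -/
theorem norm_add_norm_sub_le
    (hsum : ∀ z, Tendsto (fun j => ∑ i ∈ A j, c i z • e i) l (𝓝 z))
    (hnorm : ∀ F G : StrongDual ℝ X, ‖F‖ ≤ 1 → ‖G‖ ≤ 1 → ∀ ε > 0,
      ∀ᶠ j in l, ‖F + ∑ i ∈ A j, (G - F) (e i) • c i‖ ≤ 1 + ε)
    {φ : StrongDual ℝ (StrongDual ℝ X)} {x : X} (hx : ∀ i, c i x = φ (c i)) :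
    ‖x‖ + ‖φ - NormedSpace.inclusionInDoubleDual ℝ X x‖ ≤ ‖φ‖ := by
  obtain ⟨G, hG, hGx⟩ := exists_dual_vector'' ℝ x
  have main : ∀ F : StrongDual ℝ X, ‖F‖ ≤ 1 → φ F - F x ≤ ‖φ‖ - ‖x‖ := by
    intro F hF
    refine le_of_forall_pos_le_add fun ε hε => ?_
    set η := ε / (‖φ‖ + 2) with hη
    have hφ2 : 0 < ‖φ‖ + 2 := by linarith [norm_nonneg φ]
    have hη0 : 0 < η := div_pos hε hφ2
    obtain ⟨j, hj, hAn⟩ := (((hsum x).eventually (Metric.ball_mem_nhds x hη0)).and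
      (hnorm F G hF hG η hη0)).exists
    set p := ∑ i ∈ A j, c i x • e i with hp
    have hpx : ‖p - x‖ ≤ η := by
      rw [← dist_eq_norm]
      exact (Metric.mem_ball.1 hj).le
    have h1 : φ (F + ∑ i ∈ A j, (G - F) (e i) • c i) = φ F + (G - F) p := by
      rw [map_add, map_sum, hp, map_sum]
      congr 1
      refine Finset.sum_congr rfl fun i _ => ?_
      rw [map_smul, map_smul, smul_eq_mul, smul_eq_mul, hx, mul_comm]
    have h2 := (Real.le_norm_self _).trans (φ.le_opNorm_of_le hAn)
    have h3 := (Real.le_norm_self _).trans ((F.le_of_opNorm_le hF (p - x)))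
    have h4 := (neg_le_abs _).trans ((G.le_of_opNorm_le hG (p - x)))
    have h5 : η * (‖φ‖ + 2) = ε := div_mul_cancel₀ _ hφ2.ne'
    rw [h1, sub_apply] at h2
    rw [map_sub] at h3 h4
    have h6 : G x = ‖x‖ := hGx
    linarith
  have h0 : 0 ≤ ‖φ‖ - ‖x‖ := by simpa using main 0 (by simp)
  have := ContinuousLinearMap.opNorm_le_of_unit_norm
    (f := φ - NormedSpace.inclusionInDoubleDual ℝ X x) h0 fun F hF => by
      rw [Real.norm_eq_abs, sub_apply, NormedSpace.dual_def, abs_le']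
      refine ⟨main F hF.le, ?_⟩
      have := main (-F) (by simpa using hF.le)
      simp only [map_neg, neg_apply] at this
      linarith
  linarith

/-- A criterion for `L`-embeddedness of a space in which the truncated expansions
`P_A z = ∑_{i ∈ A} cᵢ(z) eᵢ` converge to `z`. The projection sends `φ` to the vector with the
coordinates `φ (cᵢ)`. Hypothesis `hnorm` says that a functional `F` may be replaced by another
functional `G` on the range of `P_A` at almost no cost in norm. -/
theorem isLEmbedded_of_expansion
    (hsum : ∀ z, Tendsto (fun j => ∑ i ∈ A j, c i z • e i) l (𝓝 z))
    (hlift : ∀ φ : StrongDual ℝ (StrongDual ℝ X), ∃ x, ∀ i, c i x = φ (c i))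
    (hnorm : ∀ F G : StrongDual ℝ X, ‖F‖ ≤ 1 → ‖G‖ ≤ 1 → ∀ ε > 0,
      ∀ᶠ j in l, ‖F + ∑ i ∈ A j, (G - F) (e i) • c i‖ ≤ 1 + ε) :
    IsLEmbedded X := by
  have huniq : ∀ z w : X, (∀ i, c i z = c i w) → z = w := fun z w hzw => by
    have h := hsum z
    simp only [hzw] at h
    exact tendsto_nhds_unique h (hsum w)
  choose J hJ using hlift
  have hle := fun φ => norm_add_norm_sub_le hsum hnorm (hJ φ)
  let T : StrongDual ℝ (StrongDual ℝ X) →L[ℝ] X := LinearMap.mkContinuous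
    { toFun := J
      map_add' := fun φ ψ => huniq _ _ fun i => by simp [hJ]
      map_smul' := fun a φ => huniq _ _ fun i => by simp [hJ] } 1
    fun φ => by
      have := hle φ
      have := norm_nonneg (φ - NormedSpace.inclusionInDoubleDual ℝ X (J φ))
      simp only [LinearMap.coe_mk, AddHom.coe_mk]
      linarith
  have hT : ∀ x, T (NormedSpace.inclusionInDoubleDual ℝ X x) = x := fun x =>
    huniq _ _ fun i => hJ _ i
  refine ⟨(NormedSpace.inclusionInDoubleDual ℝ X).comp T, fun φ => ?_, ?_, fun φ => ?_⟩
  · simp only [ContinuousLinearMap.comp_apply, hT]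
  · refine Set.Subset.antisymm ?_ ?_
    · rintro _ ⟨φ, rfl⟩
      exact ⟨T φ, rfl⟩
    · rintro _ ⟨x, rfl⟩
      refine ⟨NormedSpace.inclusionInDoubleDual ℝ X x, ?_⟩
      simp only [ContinuousLinearMap.comp_apply, hT]
  · refine le_antisymm ?_ ?_
    · exact (add_le_add_left (NormedSpace.double_dual_bound ℝ X _) _).trans (hle φ)
    · simpa using norm_add_le (((NormedSpace.inclusionInDoubleDual ℝ X).comp T) φ)
        (φ - ((NormedSpace.inclusionInDoubleDual ℝ X).comp T) φ)

end LEmbedded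

/-! ### Bases with the norm `α ‖·‖₁ + ‖·‖₂` -/

/-- The sequence `b` is a basis, with the coordinate functionals `c`, on whose finite linear
combinations the norm is `α` times the `ℓ₁`-norm plus the `ℓ₂`-norm of the coefficients. -/
structure IsMixedBasis {X : Type*} [NormedAddCommGroup X] [NormedSpace ℝ X] (α : ℝ) (b : ℕ → X)
    (c : ℕ → StrongDual ℝ X) : Prop where
  pos : 0 < α
  hasSum : ∀ w, HasSum (fun k => c k w • b k) w
  apply : ∀ j k, c j (b k) = if j = k then 1 else 0
  norm_sum : ∀ (A : Finset ℕ) (a : ℕ → ℝ),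
    ‖∑ k ∈ A, a k • b k‖ = α * ∑ k ∈ A, |a k| + √(∑ k ∈ A, a k ^ 2)

namespace IsMixedBasis

variable {X : Type*} [NormedAddCommGroup X] [NormedSpace ℝ X] {α : ℝ} {b : ℕ → X}
  {c : ℕ → StrongDual ℝ X}

theorem norm_apply (h : IsMixedBasis α b c) (k : ℕ) : ‖b k‖ = α + 1 := by
  simpa using h.norm_sum {k} fun _ => 1

theorem isBounded_range (h : IsMixedBasis α b c) : Bornology.IsBounded (Set.range b) :=
  isBounded_iff_forall_norm_le.2 ⟨α + 1, by rintro _ ⟨k, rfl⟩; exact (h.norm_apply k).le⟩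

theorem norm_sub (h : IsMixedBasis α b c) {j k : ℕ} (hjk : j ≠ k) :
    ‖b j - b k‖ = 2 * α + √2 := by
  have h1 := h.norm_sum {j, k} (fun i => if i = j then 1 else -1)
  rw [Finset.sum_pair hjk, Finset.sum_pair hjk, Finset.sum_pair hjk] at h1
  simp only [if_true, if_neg hjk.symm, one_smul, neg_smul, ← sub_eq_add_neg] at h1
  rw [h1]
  norm_num
  ring

theorem norm_sum_sign_smul_le (h : IsMixedBasis α b c) (A : Finset ℕ) (σ : ℕ → ℝ)
    (hσ : ∀ k, |σ k| ≤ 1) : ‖∑ k ∈ A, σ k • b k‖ ≤ α * A.card + √A.card := by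
  rw [h.norm_sum]
  have h1 : ∑ k ∈ A, |σ k| ≤ A.card := by
    simpa using Finset.sum_le_card_nsmul A (fun k => |σ k|) 1 fun k _ => hσ k
  have h2 : ∑ k ∈ A, σ k ^ 2 ≤ A.card := by
    simpa using Finset.sum_le_card_nsmul A (fun k => σ k ^ 2) 1
      fun k _ => (sq_le_one_iff_abs_le_one _).2 (hσ k)
  exact add_le_add (mul_le_mul_of_nonneg_left h1 h.pos.le) (Real.sqrt_le_sqrt h2)

/-- The part of `w` between two finite sets contributes at least `α` times its `ℓ₁`-norm. -/
theorem norm_sum_add_le (h : IsMixedBasis α b c) {A B : Finset ℕ} (hAB : A ⊆ B) (w : X) :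
    ‖∑ k ∈ A, c k w • b k‖ + α * (∑ k ∈ B, |c k w| - ∑ k ∈ A, |c k w|) ≤
      ‖∑ k ∈ B, c k w • b k‖ := by
  have h1 := Real.sqrt_le_sqrt
    (Finset.sum_le_sum_of_subset_of_nonneg hAB fun k _ _ => sq_nonneg (c k w))
  rw [h.norm_sum, h.norm_sum]
  linarith

theorem norm_sum_range_le (h : IsMixedBasis α b c) (K : ℕ) (w : X) :
    ‖∑ k ∈ Finset.range K, c k w • b k‖ ≤ ‖w‖ := by
  refine ge_of_tendsto (h.hasSum w).tendsto_sum_nat.norm ?_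
  filter_upwards [eventually_ge_atTop K] with M hM
  have h1 := h.norm_sum_add_le (Finset.range_subset_range.2 hM) w
  have h2 := Finset.sum_le_sum_of_subset_of_nonneg (Finset.range_subset_range.2 hM)
    fun k _ _ => abs_nonneg (c k w)
  have h3 := mul_nonneg h.pos.le (sub_nonneg.2 h2)
  linarith

theorem summable_abs (h : IsMixedBasis α b c) (w : X) : Summable fun k => |c k w| := by
  refine summable_of_sum_range_le (c := ‖w‖ / α) (fun _ => abs_nonneg _) fun K => ?_
  rw [le_div_iff₀' h.pos]
  refine le_trans ?_ (h.norm_sum_range_le K w)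
  rw [h.norm_sum]
  exact le_add_of_nonneg_right (Real.sqrt_nonneg _)

/-- The part of `w` from index `K` on contributes at least `α` times its `ℓ₁`-norm. -/
theorem norm_sum_range_add_le (h : IsMixedBasis α b c) (K : ℕ) (w : X) :
    ‖∑ k ∈ Finset.range K, c k w • b k‖ +
      α * (∑' k, |c k w| - ∑ k ∈ Finset.range K, |c k w|) ≤ ‖w‖ := by
  have h1 := (h.summable_abs w).hasSum.tendsto_sum_nat
  refine le_of_tendsto_of_tendsto (((h1.sub_const _).const_mul α).const_add _)
    (h.hasSum w).tendsto_sum_nat.norm ?_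
  filter_upwards [eventually_ge_atTop K] with M hM
  exact h.norm_sum_add_le (Finset.range_subset_range.2 hM) w

/-- A functional which is bounded by `β` on the basis vectors from index `K` on is bounded by `β`
times the `ℓ₁`-norm on tails. -/
theorem norm_apply_tail_le (h : IsMixedBasis α b c) {F : StrongDual ℝ X} {β : ℝ} {K : ℕ}
    (hF : ∀ k ≥ K, |F (b k)| ≤ β) (w : X) :
    ‖F (w - ∑ k ∈ Finset.range K, c k w • b k)‖ ≤
      β * (∑' k, |c k w| - ∑ k ∈ Finset.range K, |c k w|) := by
  have h1 := (hasSum_nat_add_iff' K).2 ((h.hasSum w).mapL F)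
  have h2 := ((hasSum_nat_add_iff' K).2 (h.summable_abs w).hasSum).mul_left β
  rw [map_sub, map_sum, ← h1.tsum_eq]
  refine tsum_of_norm_bounded h2 fun k => ?_
  rw [map_smul, norm_smul, mul_comm]
  exact mul_le_mul_of_nonneg_right (hF _ (Nat.le_add_left _ _)) (norm_nonneg _)

/-- Absolutely summable coordinates define an element of a complete space with a mixed basis. -/
theorem exists_apply_eq [CompleteSpace X] (h : IsMixedBasis α b c) {a : ℕ → ℝ}
    (ha : Summable fun k => |a k|) :
    ∃ w : X, HasSum (fun k => a k • b k) w ∧ ∀ k, c k w = a k := by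
  have hs : Summable fun k => a k • b k := by
    refine Summable.of_norm ?_
    simpa only [norm_smul, h.norm_apply, Real.norm_eq_abs] using ha.mul_right (α + 1)
  refine ⟨_, hs.hasSum, fun k => ?_⟩
  rw [← (hs.hasSum.mapL (c k)).tsum_eq, tsum_eq_single k]
  · simp [h.apply]
  · intro j hj
    simp [h.apply, hj.symm]

/-- The coordinates of an element with respect to a mixed basis, as a sequence in `ℓ₁`. -/
noncomputable def toEll1 (h : IsMixedBasis α b c) : X →L[ℝ] Ell1 :=
  LinearMap.mkContinuous
    { toFun := fun w => ⟨fun k => c k w, memℓp_gen (by simpa using h.summable_abs w)⟩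
      map_add' := fun v w => by
        ext k
        exact map_add (c k) v w
      map_smul' := fun r w => by
        ext k
        exact map_smul (c k) r w } α⁻¹
    fun w => by
      refine le_of_eq_of_le (hasSum_norm_lp_one _).tsum_eq.symm ?_
      rw [inv_mul_eq_div, le_div_iff₀' h.pos]
      simpa using h.norm_sum_range_add_le 0 w

theorem toEll1_apply (h : IsMixedBasis α b c) (w : X) (k : ℕ) : h.toEll1 w k = c k w := rfl

theorem hasSum_abs (h : IsMixedBasis α b c) (w : X) :
    HasSum (fun k => |c k w|) ‖h.toEll1 w‖ :=
  hasSum_norm_lp_one (h.toEll1 w)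

theorem mul_norm_toEll1_le (h : IsMixedBasis α b c) (w : X) : α * ‖h.toEll1 w‖ ≤ ‖w‖ := by
  simpa [(h.hasSum_abs w).tsum_eq] using h.norm_sum_range_add_le 0 w

/-- A space with a mixed basis is isomorphic to `ℓ₁`. -/
theorem hasSchurProperty (h : IsMixedBasis α b c) : HasSchurProperty X := by
  refine (HasSchurProperty.lp_one fun _ => hasSchurProperty_real).of_bound h.toEll1 (α + 1) ?_
  intro w
  rw [mul_comm]
  have h1 := (h.hasSum_abs w).mul_right (α + 1)
  refine (congrArg norm (h.hasSum w).tsum_eq).symm.trans_le ?_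
  refine tsum_of_norm_bounded h1 fun k => ?_
  rw [norm_smul, h.norm_apply, Real.norm_eq_abs]

theorem ca_eq (h : IsMixedBasis α b c) : ca b = 2 * α + √2 :=
  ca_eq_of_norm_sub (by have := h.pos; positivity) fun _ _ hjk => h.norm_sub hjk

/-- The functional `w ↦ α ∑ (-1)ᵏ wₖ` separates the even from the odd subsequence. -/
theorem delta_eq (h : IsMixedBasis α b c) : delta b = 2 * α := by
  refine le_antisymm (delta_le h.pos.le fun F hF ε hε =>
    eventually_abs_apply_le h.norm_sum_sign_smul_le hF hε) ?_
  let f : ℕ → StrongDual ℝ ℝ := fun k => (-1 : ℝ) ^ k • ContinuousLinearMap.id ℝ ℝ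
  have hf : ∀ k, ‖f k‖ ≤ 1 := fun k => by simp [f, norm_smul]
  let F : StrongDual ℝ X := α • (lpOneDual f hf).comp h.toEll1
  have hFa : ∀ w, F w = α * lpOneDual f hf (h.toEll1 w) := fun _ => rfl
  have hF : ‖F‖ ≤ 1 := by
    refine ContinuousLinearMap.opNorm_le_bound _ zero_le_one fun w => ?_
    have h1 : ‖lpOneDual f hf (h.toEll1 w)‖ ≤ ‖h.toEll1 w‖ := by
      refine ((lpOneDual f hf).le_of_opNorm_le ?_ _).trans_eq (one_mul _)
      exact LinearMap.mkContinuous_norm_le _ zero_le_one _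
    rw [hFa, norm_mul, Real.norm_of_nonneg h.pos.le, one_mul]
    exact (mul_le_mul_of_nonneg_left h1 h.pos.le).trans (h.mul_norm_toEll1_le w)
  have hFx : ∀ k, F (b k) = α * (-1) ^ k := by
    intro k
    rw [hFa, lpOneDual_apply, tsum_eq_single k]
    · simp [f, toEll1_apply, h.apply]
    · intro j hj
      simp [toEll1_apply, h.apply, hj]
  have h2 := sub_le_delta h.isBounded_range (u := fun k => 2 * k) (v := fun k => 2 * k + 1)
    (a := α) (b := -α) (tendsto_atTop_mono (fun k => by simp only [id]; omega) tendsto_id)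
    (tendsto_atTop_mono (fun k => by simp only [id]; omega) tendsto_id) hF
    (fun k => by simp [hFx, pow_mul]) (fun k => by simp [hFx, pow_mul, pow_succ])
  linarith

end IsMixedBasis

/-! ### `ℓ₁`-sums of spaces with mixed bases -/

section MixedSum

variable {E : ℕ → Type*} [∀ n, NormedAddCommGroup (E n)] [∀ n, NormedSpace ℝ (E n)]
  {α : ℕ → ℝ} {b : ∀ n, ℕ → E n} {c : ∀ n, ℕ → StrongDual ℝ (E n)}

/-- The image in the `ℓ₁`-sum of the `k`-th basis vector of the `n`-th summand, where
`p = (n, k)`. -/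
noncomputable def sumBasis (b : ∀ n, ℕ → E n) (p : ℕ × ℕ) : lp E 1 := lpOneInj p.1 (b p.1 p.2)

/-- The `k`-th coordinate in the `n`-th summand, where `p = (n, k)`. -/
noncomputable def sumCoord (c : ∀ n, ℕ → StrongDual ℝ (E n)) (p : ℕ × ℕ) :
    StrongDual ℝ (lp E 1) :=
  (c p.1 p.2).comp (lpOneProj p.1)

theorem sumCoord_apply (n k : ℕ) (z : lp E 1) : sumCoord c (n, k) z = c n k (z n) := rfl

/-- The index set of the first `K` basis vectors in each of the first `N` summands, where
`p = (N, K)`. -/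
def box (p : ℕ × ℕ) : Finset (ℕ × ℕ) := Finset.range p.1 ×ˢ Finset.range p.2

theorem sum_box_smul_sumBasis (a : ℕ × ℕ → ℝ) (N K : ℕ) :
    ∑ p ∈ box (N, K), a p • sumBasis b p =
      ∑ n ∈ Finset.range N, lpOneInj n (∑ k ∈ Finset.range K, a (n, k) • b n k) := by
  rw [box, Finset.sum_product]
  refine Finset.sum_congr rfl fun n _ => ?_
  rw [map_sum]
  exact Finset.sum_congr rfl fun k _ => (map_smul (lpOneInj n) _ _).symm

/-- The filter of pairs `(N, K)` in which first `K` and then `N` tends to infinity. -/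
def iterAtTop : Filter (ℕ × ℕ) := Filter.curry atTop atTop

instance : iterAtTop.NeBot := by
  refine ⟨fun h => ?_⟩
  have h1 : ∀ᶠ j in iterAtTop, False := by rw [h]; exact eventually_bot
  obtain ⟨N, hN⟩ := (eventually_curry_iff.1 h1).exists
  exact hN.exists.choose_spec

theorem tendsto_sum_box (h : ∀ n, IsMixedBasis (α n) (b n) (c n)) (z : lp E 1) :
    Tendsto (fun j => ∑ p ∈ box j, sumCoord c p z • sumBasis b p) iterAtTop (𝓝 z) := by
  rw [tendsto_nhds]
  intro U hU hzU
  refine eventually_curry_iff.2 ?_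
  have h1 : Tendsto (fun N => ∑ n ∈ Finset.range N, lpOneInj n (z n)) atTop (𝓝 z) :=
    tendsto_sum_lpOneInj z
  filter_upwards [h1.eventually (hU.mem_nhds hzU)] with N hN
  have h2 : Tendsto (fun K => ∑ p ∈ box (N, K), sumCoord c p z • sumBasis b p) atTop
      (𝓝 (∑ n ∈ Finset.range N, lpOneInj n (z n))) := by
    simp only [sum_box_smul_sumBasis, sumCoord_apply]
    refine tendsto_finsetSum _ fun n _ => ?_
    exact ((lpOneInj n).continuous.tendsto _).comp ((h n).hasSum (z n)).tendsto_sum_nat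
  exact h2.eventually (hU.mem_nhds hN)

theorem norm_sum_box_le (h : ∀ n, IsMixedBasis (α n) (b n) (c n)) (z : lp E 1) (N K : ℕ) :
    ‖∑ p ∈ box (N, K), sumCoord c p z • sumBasis b p‖ ≤ ‖z‖ := by
  rw [sum_box_smul_sumBasis, norm_sum_lpOneInj]
  have h1 := norm_sub_sum_lpOneInj z (Finset.range N)
  have h2 : ∑ n ∈ Finset.range N, ‖∑ k ∈ Finset.range K, sumCoord c (n, k) z • b n k‖ ≤
      ∑ n ∈ Finset.range N, ‖z n‖ :=
    Finset.sum_le_sum fun n _ => (h n).norm_sum_range_le K (z n)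
  linarith [norm_nonneg (z - ∑ n ∈ Finset.range N, lpOneInj n (z n))]

theorem norm_sum_sign_smul_sumBasis_le (h : ∀ n, IsMixedBasis (α n) (b n) (c n)) (n : ℕ)
    (A : Finset ℕ) (σ : ℕ → ℝ)
    (hσ : ∀ k, |σ k| ≤ 1) :
    ‖∑ k ∈ A, σ k • sumBasis b (n, k)‖ ≤ α n * A.card + √A.card := by
  have hA : ∑ k ∈ A, σ k • sumBasis b (n, k) = lpOneInj n (∑ k ∈ A, σ k • b n k) := by
    rw [map_sum]
    exact Finset.sum_congr rfl fun k _ => (map_smul (lpOneInj n) _ _).symm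
  rw [hA, norm_lpOneInj]
  exact (h n).norm_sum_sign_smul_le A σ hσ

/-- On tails of the `n`-th summand the functional `F` is bounded by `(1 + ε) α n` times the
`ℓ₁`-norm, while a tail adds at least `α n` times its `ℓ₁`-norm to the norm. Hence replacing `F` by
`G` on a box which is long enough in `k` increases the norm only slightly. -/
theorem eventually_norm_add_sum_box_le (h : ∀ n, IsMixedBasis (α n) (b n) (c n))
    {F G : StrongDual ℝ (lp E 1)} (hF : ‖F‖ ≤ 1) (hG : ‖G‖ ≤ 1)
    {ε : ℝ} (hε : 0 < ε) :
    ∀ᶠ j in iterAtTop, ‖F + ∑ p ∈ box j, (G - F) (sumBasis b p) • sumCoord c p‖ ≤ 1 + ε := by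
  refine eventually_curry_iff.2 (Eventually.of_forall fun N => ?_)
  have h1 : ∀ᶠ K in atTop, ∀ n ∈ Finset.range N, ∀ k ≥ K,
      |F (sumBasis b (n, k))| ≤ α n * (1 + ε) := by
    refine (Finset.eventually_all _).2 fun n _ => eventually_forall_ge_atTop.2 ?_
    have := eventually_abs_apply_le (norm_sum_sign_smul_sumBasis_le h n) hF
      (mul_pos (h n).pos hε)
    simpa only [mul_add, mul_one] using this
  filter_upwards [h1] with K hK
  refine ContinuousLinearMap.opNorm_le_bound _ (by positivity) fun z => ?_
  set t : ∀ n, E n := fun n =>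
    ∑ k ∈ Finset.range K, c n k (z n) • b n k with ht
  have hP : ∑ p ∈ box (N, K), sumCoord c p z • sumBasis b p =
      ∑ n ∈ Finset.range N, lpOneInj n (t n) :=
    sum_box_smul_sumBasis _ N K
  have hval : (F + ∑ p ∈ box (N, K), (G - F) (sumBasis b p) • sumCoord c p) z =
      G (∑ n ∈ Finset.range N, lpOneInj n (t n)) +
        (∑ n ∈ Finset.range N, F (lpOneInj n (z n - t n)) +
        F (z - ∑ n ∈ Finset.range N, lpOneInj n (z n))) := by
    have h2 : (∑ p ∈ box (N, K), (G - F) (sumBasis b p) • sumCoord c p) z =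
        (G - F) (∑ n ∈ Finset.range N, lpOneInj n (t n)) := by
      rw [← hP, map_sum, sum_apply]
      refine Finset.sum_congr rfl fun p _ => ?_
      rw [map_smul, smul_apply, smul_eq_mul, smul_eq_mul, mul_comm]
    rw [add_apply, h2, sub_apply]
    simp only [map_sub, map_sum, Finset.sum_sub_distrib]
    ring
  have hA : ‖G (∑ n ∈ Finset.range N, lpOneInj n (t n))‖ ≤ ∑ n ∈ Finset.range N, ‖t n‖ := by
    simpa only [one_mul, norm_sum_lpOneInj] using
      G.le_of_opNorm_le hG (∑ n ∈ Finset.range N, lpOneInj n (t n))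
  have hC : ‖F (z - ∑ n ∈ Finset.range N, lpOneInj n (z n))‖ ≤
      ‖z‖ - ∑ n ∈ Finset.range N, ‖z n‖ := by
    simpa only [one_mul, norm_sub_sum_lpOneInj] using
      F.le_of_opNorm_le hF (z - ∑ n ∈ Finset.range N, lpOneInj n (z n))
  have hB : ∀ n ∈ Finset.range N, ‖t n‖ + ‖F (lpOneInj n (z n - t n))‖ ≤ (1 + ε) * ‖z n‖ := by
    intro n hn
    have h3 : ‖F (lpOneInj n (z n - t n))‖ ≤ _ :=
      (h n).norm_apply_tail_le (F := F.comp (lpOneInj n)) (hK n hn) (z n)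
    have h4 : ‖t n‖ + _ ≤ _ := (h n).norm_sum_range_add_le K (z n)
    have h5 := mul_le_mul_of_nonneg_left h4 (show 0 ≤ 1 + ε by positivity)
    have h6 := mul_nonneg hε.le (norm_nonneg (t n))
    linarith
  have hB' := Finset.sum_le_sum hB
  rw [Finset.sum_add_distrib, ← Finset.mul_sum] at hB'
  have h7 := norm_sum_le (Finset.range N) fun n => F (lpOneInj n (z n - t n))
  have h8 : 0 ≤ ε * (‖z‖ - ∑ n ∈ Finset.range N, ‖z n‖) :=
    mul_nonneg hε.le ((norm_nonneg _).trans hC)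
  rw [hval]
  refine (norm_add_le _ _).trans ((add_le_add_right (norm_add_le _ _) _).trans ?_)
  linarith

/-- The coordinates of a functional on the dual define an element of the `ℓ₁`-sum, as the
partial sums of its expansion are bounded in norm. -/
theorem exists_sumCoord_eq [∀ n, CompleteSpace (E n)] (h : ∀ n, IsMixedBasis (α n) (b n) (c n))
    (φ : StrongDual ℝ (StrongDual ℝ (lp E 1))) :
    ∃ x : lp E 1, ∀ p, sumCoord c p x = φ (sumCoord c p) := by
  have hbound : ∀ N K : ℕ, ∑ n ∈ Finset.range N,
      ‖∑ k ∈ Finset.range K, φ (sumCoord c (n, k)) • b n k‖ ≤ ‖φ‖ := by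
    intro N K
    rw [← norm_sum_lpOneInj, ← sum_box_smul_sumBasis (fun p => φ (sumCoord c p))]
    set v := ∑ p ∈ box (N, K), φ (sumCoord c p) • sumBasis b p with hv
    obtain ⟨G, hG, hGv⟩ := exists_dual_vector'' ℝ v
    have hGv' : G v = ‖v‖ := hGv
    have h1 : ‖∑ p ∈ box (N, K), G (sumBasis b p) • sumCoord c p‖ ≤ 1 := by
      refine ContinuousLinearMap.opNorm_le_bound _ zero_le_one fun z => ?_
      have h2 : (∑ p ∈ box (N, K), G (sumBasis b p) • sumCoord c p) z =
          G (∑ p ∈ box (N, K), sumCoord c p z • sumBasis b p) := by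
        rw [map_sum, sum_apply]
        refine Finset.sum_congr rfl fun p _ => ?_
        rw [map_smul, smul_apply, smul_eq_mul, smul_eq_mul, mul_comm]
      rw [h2]
      exact G.le_of_opNorm_le_of_le hG (norm_sum_box_le h z N K)
    have h3 : φ (∑ p ∈ box (N, K), G (sumBasis b p) • sumCoord c p) = G v := by
      rw [hv, map_sum, map_sum]
      refine Finset.sum_congr rfl fun p _ => ?_
      rw [map_smul, map_smul, smul_eq_mul, smul_eq_mul, mul_comm]
    rw [← hGv', ← h3]
    exact (Real.le_norm_self _).trans ((φ.le_opNorm_of_le h1).trans_eq (mul_one _))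
  have hsummable : ∀ n, Summable fun k => |φ (sumCoord c (n, k))| := by
    intro n
    refine summable_of_sum_range_le (c := ‖φ‖ / α n) (fun _ => abs_nonneg _) fun K => ?_
    rw [le_div_iff₀' (h n).pos]
    have h1 := Finset.single_le_sum (f := fun n =>
      ‖∑ k ∈ Finset.range K, φ (sumCoord c (n, k)) • b n k‖)
      (fun _ _ => norm_nonneg _) (Finset.self_mem_range_succ n)
    refine le_trans ?_ (h1.trans (hbound (n + 1) K))
    rw [(h n).norm_sum]
    exact le_add_of_nonneg_right (Real.sqrt_nonneg _)
  choose w hw hwc using fun n => (h n).exists_apply_eq (hsummable n)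
  have hw' : ∀ N, ∑ n ∈ Finset.range N, ‖w n‖ ≤ ‖φ‖ := fun N =>
    le_of_tendsto' (tendsto_finsetSum _ fun n _ => (hw n).tendsto_sum_nat.norm) fun K => hbound N K
  have hmem : Memℓp w 1 := memℓp_gen (by
    simpa only [ENNReal.toReal_one, Real.rpow_one] using
      summable_of_sum_range_le (fun _ => norm_nonneg _) hw')
  exact ⟨⟨w, hmem⟩, fun p => hwc p.1 p.2⟩

theorem isLEmbedded_lp_one [∀ n, CompleteSpace (E n)]
    (h : ∀ n, IsMixedBasis (α n) (b n) (c n)) : IsLEmbedded (lp E 1) :=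
  isLEmbedded_of_expansion (tendsto_sum_box h) (exists_sumCoord_eq h)
    fun _ _ hF hG _ hε => eventually_norm_add_sum_box_le h hF hG hε

theorem separableSpace_lp_one (h : ∀ n, IsMixedBasis (α n) (b n) (c n)) :
    TopologicalSpace.SeparableSpace (lp E 1) := by
  rw [← TopologicalSpace.isSeparable_univ_iff]
  refine ((Set.countable_range (sumBasis b)).isSeparable.span (R := ℝ)).closure.mono fun z _ => ?_
  refine mem_closure_of_tendsto (tendsto_sum_box h z) (Eventually.of_forall fun j => ?_)
  exact Submodule.sum_mem _ fun p _ => Submodule.smul_mem _ _ (Submodule.subset_span ⟨p, rfl⟩)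

/-- The bases of the summands satisfy `ca = 2 α n + √2` and `delta ≤ 2 α n`, which contradicts
the `C`-Schur property once `2 C α n < 1`. -/
theorem not_hasCSchurProperty_lp_one (h : ∀ n, IsMixedBasis (α n) (b n) (c n))
    (hα : Tendsto α atTop (𝓝 0)) {C : ℝ} (hC : 0 ≤ C) : ¬ HasCSchurProperty (lp E 1) C := by
  intro hS
  have hlim : Tendsto (fun n => C * (2 * α n)) atTop (𝓝 0) := by
    simpa using (hα.const_mul 2).const_mul C
  obtain ⟨n, hn⟩ := (hlim.eventually_lt_const zero_lt_one).exists
  have hbdd : Bornology.IsBounded (Set.range fun k => sumBasis b (n, k)) := by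
    refine isBounded_iff_forall_norm_le.2 ⟨α n + 1, ?_⟩
    rintro _ ⟨k, rfl⟩
    exact ((norm_lpOneInj n _).trans ((h n).norm_apply k)).le
  have hca : ca (fun k => sumBasis b (n, k)) = 2 * α n + √2 := by
    refine ca_eq_of_norm_sub (by have := (h n).pos; positivity) fun j k hjk => ?_
    refine (congrArg norm (map_sub (lpOneInj n) _ _).symm).trans ?_
    rw [norm_lpOneInj, (h n).norm_sub hjk]
  have hdelta : delta (fun k => sumBasis b (n, k)) ≤ 2 * α n :=
    delta_le (h n).pos.le fun F hF ε hε =>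
      eventually_abs_apply_le (norm_sum_sign_smul_sumBasis_le h n) hF hε
  have h1 := (hS _ hbdd).trans (mul_le_mul_of_nonneg_left hdelta hC)
  rw [hca] at h1
  have h3 : (1 : ℝ) ≤ √2 := Real.one_le_sqrt.2 one_le_two
  linarith [(h n).pos]

end MixedSum

/-! ### The spaces `X_α` -/

section XAlpha

variable (α : {a : ℝ // 0 < a})

instance Scaled.instCompleteSpace (E : Type*) [NormedAddCommGroup E] [NormedSpace ℝ E]
    [CompleteSpace E] : CompleteSpace (Scaled α E) := by
  have hb : ∀ x : E, ‖Scaled.of α E x‖ = (α : ℝ) * ‖x‖ := fun _ => rfl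
  have h1 : Continuous (Scaled.of α E) :=
    (AddMonoidHomClass.continuous_of_bound (Scaled.of α E) α fun x => (hb x).le)
  have h2 : AntilipschitzWith ⟨(α : ℝ)⁻¹, (inv_pos.2 α.2).le⟩ (Scaled.of α E) :=
    AddMonoidHomClass.antilipschitz_of_bound (Scaled.of α E) fun x => by
      rw [hb]
      exact (inv_mul_cancel_left₀ α.2.ne' _).ge
  have h3 : IsUniformEmbedding (Scaled.of α E) :=
    h2.isUniformEmbedding (uniformContinuous_addMonoidHom_of_continuous h1)
  exact (completeSpace_congr (e := (Scaled.of α E).toEquiv) h3).1 inferInstance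

instance XSub.instCompleteSpace : CompleteSpace (XSub α) :=
  (Submodule.isClosed_topologicalClosure _).completeSpace_coe

/-- The first component of an element of `X_α`, as a sequence in `ℓ₁`. -/
noncomputable def toEll1 : XSub α →L[ℝ] Ell1 :=
  LinearMap.mkContinuous
    { toFun := fun w => (Scaled.of α Ell1).symm (w : Y α).fst
      map_add' := fun _ _ => rfl
      map_smul' := fun _ _ => rfl } (α : ℝ)⁻¹
    fun w => by
      have h : ‖(w : Y α).fst‖ ≤ ‖w‖ := WithLp.norm_fst_le _ _
      rw [Scaled.norm_def] at h
      rw [inv_mul_eq_div, le_div_iff₀' α.2]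
      exact h

/-- The coordinate functionals on `X_α`. -/
noncomputable def coord (k : ℕ) : StrongDual ℝ (XSub α) := (lpOneProj k).comp (toEll1 α)

theorem coord_apply (k : ℕ) (w : XSub α) : coord α k w = toEll1 α w k := rfl

theorem norm_eq_toEll1_add (w : XSub α) : ‖w‖ = α * ‖toEll1 α w‖ + ‖(w : Y α).snd‖ :=
  WithLp.prod_norm_eq_of_L1 _

theorem toEll1_xvec (k : ℕ) : toEll1 α (xvec α k) = lp.single 1 k 1 := rfl

/-- The two components of an element of `X_α` are the same sequence. -/
theorem snd_apply (w : XSub α) (k : ℕ) : (w : Y α).snd k = coord α k w := by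
  let f : Y α →L[ℝ] ℝ :=
    LinearMap.mkContinuous
      { toFun := fun y => y.snd k - (Scaled.of α Ell1).symm y.fst k
        map_add' := fun y z => by
          change (y.snd k + z.snd k) - ((Scaled.of α Ell1).symm y.fst k +
            (Scaled.of α Ell1).symm z.fst k) = _
          ring
        map_smul' := fun c y => by
          change c * y.snd k - c * (Scaled.of α Ell1).symm y.fst k = c * _
          ring } (1 + (α : ℝ)⁻¹)
      fun y => by
        have h1 : ‖y.snd k‖ ≤ ‖y.snd‖ := lp.norm_apply_le_norm two_ne_zero _ _
        have h2 : ‖(Scaled.of α Ell1).symm y.fst k‖ ≤ ‖(Scaled.of α Ell1).symm y.fst‖ :=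
          lp.norm_apply_le_norm one_ne_zero _ _
        have h3 : ‖y.fst‖ ≤ ‖y‖ := WithLp.norm_fst_le _ _
        have h4 : ‖y.snd‖ ≤ ‖y‖ := WithLp.norm_snd_le _ _
        rw [Scaled.norm_def, ← le_div_iff₀' α.2, div_eq_inv_mul] at h3
        calc _ ≤ ‖y.snd k‖ + ‖(Scaled.of α Ell1).symm y.fst k‖ := norm_sub_le _ _
          _ ≤ _ := by linarith
  have hle : XSub α ≤ LinearMap.ker f.toLinearMap := by
    refine Submodule.topologicalClosure_minimal _ (Submodule.span_le.2 ?_) f.isClosed_ker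
    rintro _ ⟨j, rfl⟩
    change (lp.single 2 j (1 : ℝ) : Ell2) k - (lp.single 1 j (1 : ℝ) : Ell1) k = 0
    rw [lp.coeFn_single, lp.coeFn_single, sub_self]
  exact sub_eq_zero.1 (hle w.2)

theorem coord_xvec (j k : ℕ) : coord α j (xvec α k) = if j = k then 1 else 0 := by
  rw [coord_apply, toEll1_xvec, lp.coeFn_single, Pi.single_apply]

theorem smul_diagVec (a : ℝ) (k : ℕ) :
    a • diagVec α k = WithLp.toLp 1 (Scaled.of α Ell1 (lp.single 1 k a), lp.single 2 k a) := by
  rw [diagVec, ← WithLp.toLp_smul, Prod.smul_mk, ← map_smul, ← lp.single_smul, ← lp.single_smul,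
    smul_eq_mul, mul_one]

theorem hasSum_coord (w : XSub α) : HasSum (fun k => coord α k w • xvec α k) w := by
  have h1 : HasSum (fun k => (lp.single 1 k (toEll1 α w k) : Ell1)) (toEll1 α w) :=
    lp.hasSum_single ENNReal.one_ne_top _
  have h2 : HasSum (fun k => (lp.single 2 k ((w : Y α).snd k) : Ell2)) (w : Y α).snd :=
    lp.hasSum_single ENNReal.ofNat_ne_top _
  have h3 : Continuous (Scaled.of α Ell1) :=
    AddMonoidHomClass.continuous_of_bound (Scaled.of α Ell1) α fun x => le_rfl
  have h4 := h1.map (Scaled.of α Ell1) h3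
  have h5 := (h4.prodMk h2).mapL
    (WithLp.prodContinuousLinearEquiv 1 ℝ (Scaled α Ell1) Ell2).symm.toContinuousLinearMap
  rw [← Topology.IsInducing.subtypeVal.hasSum_iff (g := (XSub α).subtype)]
  convert h5 using 1
  · funext k
    rw [snd_apply]
    exact smul_diagVec α _ k
  · rfl

theorem norm_sum_smul_xvec (A : Finset ℕ) (a : ℕ → ℝ) :
    ‖∑ k ∈ A, a k • xvec α k‖ = α * ∑ k ∈ A, |a k| + √(∑ k ∈ A, a k ^ 2) := by
  have h1 : toEll1 α (∑ k ∈ A, a k • xvec α k) = ∑ k ∈ A, lp.single 1 k (a k) := by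
    rw [map_sum]
    refine Finset.sum_congr rfl fun k _ => ?_
    rw [map_smul, toEll1_xvec, ← lp.single_smul, smul_eq_mul, mul_one]
  have h2 : ((∑ k ∈ A, a k • xvec α k : XSub α) : Y α).snd = ∑ k ∈ A, lp.single 2 k (a k) := by
    rw [← Submodule.subtype_apply, map_sum]
    refine (map_sum (WithLp.sndₗ 1 ℝ (Scaled α Ell1) Ell2) _ _).trans ?_
    refine Finset.sum_congr rfl fun k _ => ?_
    change a k • (lp.single 2 k (1 : ℝ) : Ell2) = _
    rw [← lp.single_smul, smul_eq_mul, mul_one]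
  have h3 := lp.norm_sum_single (p := 1) (by simp) a A
  have h4 := lp.norm_sum_single (p := 2) (by simp) a A
  simp only [ENNReal.toReal_one, Real.rpow_one, Real.norm_eq_abs] at h3
  simp only [ENNReal.toReal_ofNat, Real.rpow_ofNat, Real.norm_eq_abs, sq_abs] at h4
  rw [norm_eq_toEll1_add, h1, h2, h3, ← h4, Real.sqrt_sq (norm_nonneg _)]

/-- The vectors `(e_k, e_k)` form a mixed basis of `X_α`. -/
theorem isMixedBasis_xvec : IsMixedBasis (α : ℝ) (xvec α) (coord α) where
  pos := α.2
  hasSum := hasSum_coord α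
  apply := coord_xvec α
  norm_sum := norm_sum_smul_xvec α

end XAlpha

theorem tendsto_invNat : Tendsto (fun n => (invNat n : ℝ)) atTop (𝓝 0) :=
  tendsto_one_div_add_atTop_nhds_zero_nat

end QuantSchur

theorem mainTheorem2 :
    (CompleteSpace QuantSchur.XSum ∧
      TopologicalSpace.SeparableSpace QuantSchur.XSum ∧
      QuantSchur.IsLEmbedded QuantSchur.XSum ∧
      QuantSchur.HasSchurProperty QuantSchur.XSum ∧
      ∀ C : ℝ, 0 ≤ C → ¬ QuantSchur.HasCSchurProperty QuantSchur.XSum C) ∧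
    ∀ α : {a : ℝ // 0 < a},
      Bornology.IsBounded (Set.range (QuantSchur.xvec α)) ∧
      QuantSchur.ca (QuantSchur.xvec α) = 2 * (α : ℝ) + Real.sqrt 2 ∧
      QuantSchur.delta (QuantSchur.xvec α) = 2 * (α : ℝ) := by
  have h := fun n => QuantSchur.isMixedBasis_xvec (QuantSchur.invNat n)
  refine ⟨⟨inferInstance, QuantSchur.separableSpace_lp_one h, QuantSchur.isLEmbedded_lp_one h,
    QuantSchur.HasSchurProperty.lp_one fun n => (h n).hasSchurProperty,
    fun _ hC => QuantSchur.not_hasCSchurProperty_lp_one h QuantSchur.tendsto_invNat hC⟩,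
    fun α => ?_⟩
  have hα := QuantSchur.isMixedBasis_xvec α
  exact ⟨hα.isBounded_range, hα.ca_eq, hα.delta_eq⟩
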